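/- Let $G$ be a finite group with identity $1_G$ and commutator subgroup $G'$. Let $\mathcal F(G)$ be the free abelian monoid with basis $G$; its elements $S = g_1 \cdot \ldots \cdot g_\ell$ are called sequences over $G$ (finite, unordered, repetition allowed). Let $\pi(S) = \{ g_{\tau(1)} \cdots g_{\tau(\ell)} \in G : \tau \text{ a permutation of } [1,\ell] \}$ (with $\pi(S) = \{1_G\}$ if $\ell = 0$), and let $\mathcal B(G) = \{ S \in \mathcal F(G) : 1_G \in \pi(S) \}$ be the monoid of product-one sequences. A commutative cancellative monoid $H$ with quotient group $\mathsf q(H)$ is called seminormal if every $x \in \mathsf q(H)$, for which there is an $N \in \mathbb N$ with $x^n \in H$ for all $n \ge N$, lies in $H$. Sequences $S, S' \in \mathcal F(G)$ are called equivalent if, for all $T \in \mathcal F(G)$, we have $S \cdot T \in \mathcal B(G)$ if and only if $S' \cdot T \in \mathcal B(G)$. This is a congruence relation on $\mathcal F(G)$. Let $[S]$ be the class of $S$, and let the class semigroup $\mathcal C = \mathcal C(\mathcal B(G), \mathcal F(G))$ be the commutative semigroup of all classes. Let $\mathsf E(\mathcal C)$ be the set of idempotents of $\mathcal C$. A commutative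 semigroup is called a Clifford semigroup if each of its elements lies in a subgroup, that is, in a subset which is a group under the operation of the semigroup (its identity may differ from the identity element of the semigroup). The following statements are equivalent: (a) $|G'| \le 2$. (b) $\mathcal B(G)$ is a seminormal monoid. (c) $\mathcal C$ is a Clifford semigroup. If this is the case, then $\mathcal B(G) = \{ S \in \mathcal F(G) : [S] \in \mathsf E(\mathcal C) \}$. -/

import Mathlib

namespace ProductOne

/-- The set of products `π(S)` of a sequence `S` over `G` (a finite unordered sequence with
repetition, i.e. a multiset): all the products of the terms of `S`, in any order.
For the empty sequence this is `{1}`. -/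
def products {G : Type*} [Group G] (S : Multiset G) : Set G :=
  {g | ∃ l : List G, (l : Multiset G) = S ∧ l.prod = g}

/-- The monoid `B(G)` of product-one sequences, as a submonoid of the free abelian monoid
`F(G) = Multiset G` (concatenation of sequences is written additively here). -/
def productOneMonoid (G : Type*) [Group G] : AddSubmonoid (Multiset G) where
  carrier := {S | (1 : G) ∈ products S}
  zero_mem' := ⟨[], rfl, rfl⟩
  add_mem' := by
    rintro S T ⟨l, rfl, hl⟩ ⟨m, rfl, hm⟩
    exact ⟨l ++ m, rfl, by rw [List.prod_append, hl, hm, one_mul]⟩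

/-- The seminormalization of a commutative cancellative monoid `H` (written additively): all the
`x` in the quotient group of `H` such that `n • x` lies in `H` for all sufficiently large `n`. -/
def seminormalization (H : Type*) [AddCommMonoid H] [IsCancelAdd H] :
    Set (Algebra.GrothendieckAddGroup H) :=
  {x | ∃ N : ℕ, 0 < N ∧ ∀ n : ℕ, N ≤ n →
    n • x ∈ Set.range (Algebra.GrothendieckAddGroup.of (M := H))}

/-- A commutative cancellative monoid is seminormal if it equals its seminormalization
(inside its quotient group). -/
def IsSeminormal (H : Type*) [AddCommMonoid H] [IsCancelAdd H] : Prop :=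
  Set.range (Algebra.GrothendieckAddGroup.of (M := H)) = seminormalization H

/-- `H`-equivalence on a commutative cancellative monoid `F` with a submonoid `H`:
`y ∼ y'` if `(-y + H) ∩ F = (-y' + H) ∩ F`, where `(-y + H) ∩ F = {t ∈ F | y + t ∈ H}`. -/
def equivCon {F : Type*} [AddCancelCommMonoid F] (H : AddSubmonoid F) : AddCon F where
  r y y' := {t : F | y + t ∈ H} = {t : F | y' + t ∈ H}
  iseqv := ⟨fun _ => rfl, fun h => h.symm, fun h h' => h.trans h'⟩
  add' := by
    intro a b c d hab hcd
    ext t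
    have h1 := Set.ext_iff.mp hab (c + t)
    have h2 := Set.ext_iff.mp hcd (b + t)
    simp only [Set.mem_ofPred_eq] at h1 h2 ⊢
    rw [add_assoc, h1, add_left_comm, h2, add_left_comm, add_assoc]

/-- The class semigroup `C(H, F)`: the quotient of `F` by `H`-equivalence. -/
abbrev ClassSemigroup {F : Type*} [AddCancelCommMonoid F] (H : AddSubmonoid F) : Type _ :=
  (equivCon H).Quotient

/-- The class `[y]` of `y ∈ F` in the class semigroup `C(H, F)`. -/
def classOf {F : Type*} [AddCancelCommMonoid F] (H : AddSubmonoid F) (y : F) :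
    ClassSemigroup H :=
  (equivCon H).mk' y

/-- The set `E(C)` of idempotents of a commutative semigroup `C`. -/
def idempotents (C : Type*) [AddCommSemigroup C] : Set C :=
  {e | e + e = e}

/-- A subset of a commutative semigroup is a subgroup if it is a group under the operation of the
semigroup. Its identity `e` need not be an identity element of the whole semigroup. -/
def IsSubgroup {C : Type*} [AddCommSemigroup C] (s : Set C) : Prop :=
  (∀ a ∈ s, ∀ b ∈ s, a + b ∈ s) ∧
    ∃ e ∈ s, (∀ a ∈ s, e + a = a) ∧ ∀ a ∈ s, ∃ b ∈ s, b + a = e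

/-- A commutative semigroup is a Clifford semigroup if it is a union of groups, i.e. if each of its
elements lies in a subgroup. -/
def IsClifford (C : Type*) [AddCommSemigroup C] : Prop :=
  ∀ a : C, ∃ s : Set C, IsSubgroup s ∧ a ∈ s

end ProductOne

namespace ProductOne

open scoped commutatorElement

/-! ### Products of sequences and of their powers. -/

section Products

variable {G : Type*} [Group G]

/-! The implications run (a) ⇒ (c) ⇒ (b) ⇒ (a), with seminormality first rephrased inside `Multiset
G` (`isSeminormal_iff`).

(a) ⇒ (c): if |G'| ≤ 2, a product-one `R` supported in `S` does not change the class of `S`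
(`classOf_add_eq`). If the terms commute, the product is order-independent; otherwise swapping two
noncommuting terms gives two distinct products in G', so one of them is 1. Hence [|G|·S] is an
idempotent in whose group [S] lies. The same absorption, with `R = S`, gives the final claim;
conversely an idempotent [S] equals [|G|·S].

(c) ⇒ (b): inside a group, [S] = [(n+1)S + nT] for all n, with [T] inverse to [S]; for suitable n
both summands are product-one.

(b) ⇒ (a): a sequence with a product in the commutator subgroup of the group it generates has all
large powers product-one (`eventually_nsmul_mem`), so it must itself be product-one. Thus each π(T)
is closed under multiplication by ⟨T⟩' (`mul_mem_products`). Since two terms have at most two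
products, commutators are involutions, and then central. Since three terms have at most six, all
nontrivial commutators coincide. -/

theorem mul_mem_products_add {S T : Multiset G} {p q : G} (hp : p ∈ products S)
    (hq : q ∈ products T) : p * q ∈ products (S + T) := by
  obtain ⟨l, rfl, rfl⟩ := hp
  obtain ⟨m, rfl, rfl⟩ := hq
  exact ⟨l ++ m, rfl, List.prod_append⟩

theorem pow_mem_products_nsmul {S : Multiset G} {p : G} (hp : p ∈ products S) (n : ℕ) :
    p ^ n ∈ products (n • S) := by
  induction n with
  | zero => exact ⟨[], by simp⟩
  | succ n ih => rw [pow_succ, succ_nsmul]; exact mul_mem_products_add ih hp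

theorem products_nonempty (S : Multiset G) : ∃ p, p ∈ products S :=
  ⟨S.toList.prod, S.toList, S.coe_toList, rfl⟩

theorem card_nsmul_mem [Finite G] (S : Multiset G) : Nat.card G • S ∈ productOneMonoid G := by
  obtain ⟨p, hp⟩ := products_nonempty S
  have h := pow_mem_products_nsmul hp (Nat.card G)
  rwa [pow_card_eq_one'] at h

/-- An ordering with product 1 can be rotated cyclically to put `x` first. -/
theorem inv_mem_products_of_one_mem_cons {S : Multiset G} {x : G}
    (h : (1 : G) ∈ products (x ::ₘ S)) : x⁻¹ ∈ products S := by
  obtain ⟨l, hl, h1⟩ := h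
  have hx : x ∈ l := by
    have : x ∈ (l : Multiset G) := by rw [hl]; simp
    simpa using this
  obtain ⟨s, t, rfl⟩ := List.append_of_mem hx
  refine ⟨t ++ s, ?_, ?_⟩
  · have h2 : ((s ++ x :: t : List G) : Multiset G) = x ::ₘ ((t ++ s : List G) : Multiset G) := by
      rw [Multiset.cons_coe, Multiset.coe_eq_coe]
      exact List.perm_middle.trans (List.Perm.cons x List.perm_append_comm)
    rw [h2] at hl
    exact (Multiset.cons_inj_right x).1 hl
  · rw [List.prod_append, List.prod_cons] at h1
    rw [List.prod_append]
    have h2 : s.prod = t.prod⁻¹ * x⁻¹ := by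
      rw [eq_comm, ← mul_inv_rev]
      exact inv_eq_of_mul_eq_one_left h1
    rw [h2]; group

theorem exists_mem_products_le_nsmul [Finite G] {S : Multiset G} {u : G}
    (hu : u ∈ Subgroup.closure {x | x ∈ S}) : ∃ (U : Multiset G) (n : ℕ),
      u ∈ products U ∧ U ≤ n • S := by
  classical
  rw [← Subgroup.mem_toSubmonoid, Subgroup.closure_toSubmonoid_of_finite] at hu
  obtain ⟨l, hl, rfl⟩ := Submonoid.exists_list_of_mem_closure hu
  refine ⟨l, l.length, ⟨l, rfl, rfl⟩, Multiset.le_iff_count.2 fun a ↦ ?_⟩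
  by_cases ha : a ∈ l
  · rw [Multiset.count_nsmul, Multiset.coe_count]
    exact List.count_le_length.trans
      (Nat.le_mul_of_pos_right _ (Multiset.count_pos.2 (hl a ha)))
  · rw [Multiset.coe_count, List.count_eq_zero_of_not_mem ha]
    exact Nat.zero_le _

/-- The products of the powers of `S` whose exponent is a multiple of the order of `G`. -/
def powerProducts [Finite G] (S : Multiset G) : Subgroup G where
  carrier := {p | ∃ j : ℕ, p ∈ products ((j * Nat.card G) • S)}
  one_mem' := ⟨0, [], by simp⟩
  mul_mem' := by
    rintro p q ⟨i, hp⟩ ⟨j, hq⟩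
    exact ⟨i + j, by rw [add_mul, add_nsmul]; exact mul_mem_products_add hp hq⟩
  inv_mem' := by
    rintro p ⟨j, hp⟩
    have hpos : 0 < Nat.card G := Nat.card_pos
    have h := pow_mem_products_nsmul hp (Nat.card G - 1)
    rw [← mul_nsmul', ← mul_assoc] at h
    -- Finiteness makes inverses positive powers.
    have hinv : p ^ (Nat.card G - 1) = p⁻¹ := by
      rw [eq_inv_iff_mul_eq_one, ← pow_succ, Nat.sub_add_cancel hpos, pow_card_eq_one']
    exact ⟨(Nat.card G - 1) * j, hinv ▸ h⟩

/-- A large power of `S` contains sequences with products `u` and `v`. With `r` a product of the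
remaining terms, `u * v * r` and `v * u * r` are products of the same power, and their quotient is
`⁅u, v⁆`. -/
theorem commutator_closure_le_powerProducts [Finite G] (S : Multiset G) :
    ⁅Subgroup.closure {x | x ∈ S}, Subgroup.closure {x | x ∈ S}⁆ ≤ powerProducts S := by
  rw [Subgroup.commutator_le]
  intro u hu v hv
  obtain ⟨U, m, hu, hU⟩ := exists_mem_products_le_nsmul hu
  obtain ⟨V, n, hv, hV⟩ := exists_mem_products_le_nsmul hv
  have hle : U + V ≤ ((m + n) * Nat.card G) • S := by
    calc U + V ≤ (m + n) • S := by rw [add_nsmul]; exact add_le_add hU hV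
      _ ≤ _ := nsmul_le_nsmul_left zero_le (Nat.le_mul_of_pos_right _ Nat.card_pos)
  obtain ⟨R, hR⟩ := Multiset.le_iff_exists_add.1 hle
  obtain ⟨r, hr⟩ := products_nonempty R
  have hp : u * v * r ∈ powerProducts S :=
    ⟨m + n, by rw [hR]; exact mul_mem_products_add (mul_mem_products_add hu hv) hr⟩
  have hq : v * u * r ∈ powerProducts S :=
    ⟨m + n, by
      rw [hR, add_comm U V]; exact mul_mem_products_add (mul_mem_products_add hv hu) hr⟩
  have h := (powerProducts S).mul_mem hp ((powerProducts S).inv_mem hq)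
  have he : u * v * r * (v * u * r)⁻¹ = ⁅u, v⁆ := by rw [commutatorElement_def]; group
  rwa [he] at h

theorem eventually_nsmul_mem [Finite G] {S : Multiset G} {s : G} (hs : s ∈ products S)
    (hs' : s ∈ ⁅Subgroup.closure {x | x ∈ S}, Subgroup.closure {x | x ∈ S}⁆) :
    ∃ N : ℕ, ∀ n, N ≤ n → n • S ∈ productOneMonoid G := by
  obtain ⟨j, hj⟩ := (powerProducts S).inv_mem (commutator_closure_le_powerProducts S hs')
  have h1 : (j * Nat.card G + 1) • S ∈ productOneMonoid G := by
    have h := mul_mem_products_add hj hs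
    rwa [inv_mul_cancel, ← succ_nsmul] at h
  have hpos : 0 < Nat.card G := Nat.card_pos
  -- The exponents j|G| + 1 and |G| are coprime and both work; beyond this bound, `n % |G|` copies
  -- of the first leave a nonnegative multiple of the second.
  refine ⟨j * Nat.card G * Nat.card G, fun n hn ↦ ?_⟩
  set M := Nat.card G
  have hq : j * M ≤ n / M := (Nat.le_div_iff_mul_le hpos).2 hn
  have hr : n % M < M := Nat.mod_lt _ hpos
  have hrj : j * (n % M) ≤ n / M := (Nat.mul_le_mul_left j hr.le).trans hq
  obtain ⟨d, hd⟩ := Nat.exists_eq_add_of_le hrj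
  have hn' : n = (n % M) * (j * M + 1) + d * M := by
    conv_lhs => rw [← Nat.div_add_mod n M, hd]
    ring
  rw [hn', add_nsmul, mul_nsmul', mul_nsmul']
  exact add_mem (nsmul_mem h1 _) (nsmul_mem (card_nsmul_mem S) _)

end Products

/-! ### Seminormality expressed by sequences alone. -/

section Seminormal

variable {G : Type*} [Group G]

open Algebra

variable (G) in
/-- Every sequence, all of whose sufficiently large powers are product-one sequences, is itself a
product-one sequence. -/
def ContainsEventualRoots : Prop :=
  ∀ S : Multiset G, (∃ N : ℕ, ∀ n, N ≤ n → n • S ∈ productOneMonoid G) → S ∈ productOneMonoid G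

/-- A sequence `S` with large powers in the monoid is the difference (N+1)S − NS in the quotient
group. Conversely, if x = s − t has a positive multiple in the monoid, comparing multiplicities
gives t ≤ s, so x comes from a sequence. -/
theorem isSeminormal_iff : IsSeminormal (productOneMonoid G) ↔
    ContainsEventualRoots G := by
  classical
  constructor
  · rintro h S ⟨N, hN⟩
    let s : productOneMonoid G := ⟨(N + 1) • S, hN _ (by omega)⟩
    let t : productOneMonoid G := ⟨N • S, hN _ le_rfl⟩
    have hx : GrothendieckAddGroup.of s - GrothendieckAddGroup.of t ∈
        seminormalization (productOneMonoid G) := by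
      refine ⟨N + 1, by omega, fun n hn ↦ ⟨⟨n • S, hN n (by omega)⟩, ?_⟩⟩
      rw [nsmul_sub, eq_sub_iff_add_eq, ← map_nsmul, ← map_nsmul, ← map_add]
      congr 1
      apply Subtype.ext
      change n • S + n • N • S = n • (N + 1) • S
      rw [succ_nsmul', nsmul_add]
    rw [← h] at hx
    obtain ⟨b, hb⟩ := hx
    rw [eq_sub_iff_add_eq, ← map_add] at hb
    have hb' := congrArg Subtype.val (GrothendieckAddGroup.of_injective hb)
    simp only [AddSubmonoid.coe_add, s, t, succ_nsmul'] at hb'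
    rw [← add_right_cancel hb']
    exact b.2
  · intro h
    apply Set.Subset.antisymm
    · rintro _ ⟨b, rfl⟩
      exact ⟨1, one_pos, fun n _ ↦ ⟨n • b, map_nsmul _ _ _⟩⟩
    · rintro x ⟨N, hN0, hN⟩
      obtain ⟨⟨s, ⟨t, ht⟩⟩, hx⟩ := (AddLocalization.addMonoidOf (⊤ : AddSubmonoid
        (productOneMonoid G))).surj x
      have hx' : x + GrothendieckAddGroup.of t = GrothendieckAddGroup.of s := hx
      have key : ∀ n, N ≤ n → ∃ b : productOneMonoid G,
          (b : Multiset G) + n • (t : Multiset G) = n • (s : Multiset G) := by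
        intro n hn
        obtain ⟨b, hb⟩ := hN n hn
        refine ⟨b, ?_⟩
        have h2 : GrothendieckAddGroup.of (b + n • t) = GrothendieckAddGroup.of (n • s) := by
          rw [map_add, hb, map_nsmul, map_nsmul, ← hx', nsmul_add]
        have h3 := congrArg Subtype.val (GrothendieckAddGroup.of_injective h2)
        simpa using h3
      have hle : (t : Multiset G) ≤ s := by
        rw [Multiset.le_iff_count]
        intro a
        obtain ⟨b, hb⟩ := key N le_rfl
        have h4 := congrArg (Multiset.count a) hb
        simp only [Multiset.count_add, Multiset.count_nsmul] at h4
        exact Nat.le_of_mul_le_mul_left (by omega) hN0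
      obtain ⟨S, hS⟩ := Multiset.le_iff_exists_add.1 hle
      have hSB : S ∈ productOneMonoid G := by
        refine h S ⟨N, fun n hn ↦ ?_⟩
        obtain ⟨b, hb⟩ := key n hn
        rw [hS, nsmul_add, add_comm] at hb
        rw [← add_left_cancel hb]
        exact b.2
      refine ⟨⟨S, hSB⟩, ?_⟩
      rw [← add_right_cancel_iff (a := GrothendieckAddGroup.of t), hx', ← map_add]
      congr 1
      apply Subtype.ext
      rw [hS, add_comm]; rfl

end Seminormal

/-! ### Class semigroups and subgroups at idempotents. -/

section Classes

variable {F : Type*} [AddCancelCommMonoid F] {H : AddSubmonoid F}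

theorem classOf_eq_iff {y z : F} : classOf H y = classOf H z ↔ ∀ t, y + t ∈ H ↔ z + t ∈ H := by
  rw [classOf, classOf]
  refine (AddCon.eq _).trans ?_
  exact Set.ext_iff

theorem classOf_surjective : Function.Surjective (classOf H) := AddCon.mk'_surjective

theorem classOf_add (y z : F) : classOf H (y + z) = classOf H y + classOf H z := rfl

theorem mem_of_classOf_eq {y z : F} (h : classOf H y = classOf H z) (hz : z ∈ H) : y ∈ H := by
  simpa using (classOf_eq_iff.1 h 0).2 (by simpa using hz)

/-- The elements that are invertible with respect to an idempotent form a subgroup. -/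
theorem isSubgroup_of_idempotent {C : Type*} [AddCommSemigroup C] {e : C} (he : e + e = e) :
    IsSubgroup {x : C | e + x = x ∧ ∃ y, e + y = y ∧ y + x = e} := by
  refine ⟨?_, e, ⟨he, e, he, he⟩, fun a ha ↦ ha.1, ?_⟩
  · rintro a ⟨ha, a', ha', haa⟩ b ⟨hb, b', hb', hbb⟩
    refine ⟨by rw [← add_assoc, ha], a' + b', by rw [← add_assoc, ha'], ?_⟩
    rw [add_add_add_comm, haa, hbb, he]
  · rintro a ⟨ha, a', ha', haa⟩
    exact ⟨a', ⟨ha', a, ha, by rw [add_comm, haa]⟩, haa⟩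

end Classes

/-! ### From |G'| ≤ 2 to Clifford, and from Clifford to seminormal. -/

section Main

variable {G : Type*} [Group G] [Finite G]

theorem mem_of_classOf_idempotent {S : Multiset G}
    (hS : classOf (productOneMonoid G) S ∈ idempotents (ClassSemigroup (productOneMonoid G))) :
    S ∈ productOneMonoid G := by
  have h : ∀ n : ℕ, classOf (productOneMonoid G) S =
      classOf (productOneMonoid G) ((n + 1) • S) := by
    intro n
    induction n with
    | zero => simp
    | succ n ih =>
      rw [succ_nsmul, classOf_add, ← ih]
      exact hS.symm
  have h1 := h (Nat.card G - 1)
  rw [Nat.sub_add_cancel Nat.card_pos] at h1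
  exact mem_of_classOf_eq h1 (card_nsmul_mem S)

theorem containsEventualRoots_of_isClifford
    (hC : IsClifford (ClassSemigroup (productOneMonoid G))) : ContainsEventualRoots G := by
  rintro S ⟨N, hN⟩
  obtain ⟨s, ⟨-, e, -, he, hinv⟩, ha⟩ := hC (classOf _ S)
  obtain ⟨b, hb, hba⟩ := hinv _ ha
  obtain ⟨T, rfl⟩ := classOf_surjective b
  have h : ∀ n : ℕ, classOf (productOneMonoid G) S =
      classOf (productOneMonoid G) ((n + 1) • S + n • T) := by
    intro n
    induction n with
    | zero => simp
    | succ n ih =>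
      have : (n + 1 + 1) • S + (n + 1) • T = (T + S) + ((n + 1) • S + n • T) := by
        rw [succ_nsmul _ (n + 1), succ_nsmul T n]; abel
      rw [this, classOf_add, ← ih, classOf_add, hba, he _ ha]
  -- This exponent is at least `N`, for the power of `S`, and divisible by |G|, for the power of
  -- `T`.
  refine mem_of_classOf_eq (h (N * Nat.card G)) (add_mem (hN _ ?_) ?_)
  · exact (Nat.le_mul_of_pos_right N Nat.card_pos).trans (Nat.le_succ _)
  · rw [mul_nsmul']
    exact nsmul_mem (card_nsmul_mem T) N

theorem mem_of_add_mem (hG : Nat.card (commutator G) ≤ 2) {U R : Multiset G}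
    (hR : R ∈ productOneMonoid G) (hRU : ∀ x ∈ R, x ∈ U) (h : U + R ∈ productOneMonoid G) :
    U ∈ productOneMonoid G := by
  obtain ⟨r, rfl, hr⟩ := hR
  obtain ⟨w, hw, hw1⟩ := h
  by_cases hc : ∀ x ∈ U, ∀ y ∈ U, Commute x y
  · obtain ⟨u, rfl⟩ := Quot.exists_rep U
    refine ⟨u, rfl, ?_⟩
    have hperm : (u ++ r).Perm w := Multiset.coe_eq_coe.1 hw.symm
    have hmem : ∀ x ∈ u ++ r, x ∈ (u : Multiset G) := by
      intro x hx
      rcases List.mem_append.1 hx with hx | hx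
      · exact hx
      · exact hRU x hx
    have h2 := hperm.prod_eq' (List.pairwise_of_forall_mem_list fun x hx y hy ↦
      hc x (hmem x hx) y (hmem y hy))
    rwa [List.prod_append, hr, mul_one, hw1] at h2
  · push Not at hc
    obtain ⟨g, hg, h, hh, hgh⟩ := hc
    have hne : h ≠ g := fun he ↦ hgh (he ▸ Commute.refl _)
    obtain ⟨U', rfl⟩ := Multiset.exists_cons_of_mem hg
    have hh' : h ∈ U' := (Multiset.mem_cons.1 hh).resolve_left hne
    obtain ⟨U'', rfl⟩ := Multiset.exists_cons_of_mem hh'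
    obtain ⟨u, rfl⟩ := Quot.exists_rep U''
    -- In the abelianization the product of `U + R` is 1 and `R` contributes 1.
    have hmem : (g :: h :: u).prod ∈ commutator G := by
      have hperm : (g :: h :: u ++ r).Perm w := Multiset.coe_eq_coe.1 hw.symm
      have h2 := (hperm.map Abelianization.of).prod_eq
      rw [List.prod_hom, List.prod_hom, hw1, List.prod_append, hr, mul_one, map_one] at h2
      rwa [← Abelianization.ker_of, MonoidHom.mem_ker]
    have hmem' : (h :: g :: u).prod ∈ commutator G := by
      rw [← Abelianization.ker_of, MonoidHom.mem_ker] at hmem ⊢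
      rw [← hmem]
      simp only [List.prod_cons, map_mul]
      rw [mul_left_comm]
    have hne' : (g :: h :: u).prod ≠ (h :: g :: u).prod := by
      simp only [List.prod_cons, ← mul_assoc]
      exact fun he ↦ hgh (mul_right_cancel he)
    by_contra hU
    have h1 : (g :: h :: u).prod ≠ 1 := fun he ↦ hU ⟨_, rfl, he⟩
    have h2 : (h :: g :: u).prod ≠ 1 := fun he ↦
      hU ⟨_, Multiset.coe_eq_coe.2 (List.Perm.swap _ _ _), he⟩
    have h3 : 2 < Nat.card (commutator G) := by
      classical
      have : Fintype (commutator G) := Fintype.ofFinite _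
      rw [Nat.card_eq_fintype_card, Fintype.two_lt_card_iff]
      exact ⟨1, ⟨_, hmem⟩, ⟨_, hmem'⟩, fun he ↦ h1 (congrArg Subtype.val he).symm,
        fun he ↦ h2 (congrArg Subtype.val he).symm, fun he ↦ hne' (congrArg Subtype.val he)⟩
    omega

theorem classOf_add_eq (hG : Nat.card (commutator G) ≤ 2) {S R : Multiset G}
    (hR : R ∈ productOneMonoid G) (hRS : ∀ x ∈ R, x ∈ S) :
    classOf (productOneMonoid G) (S + R) = classOf (productOneMonoid G) S := by
  rw [classOf_eq_iff]
  intro T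
  rw [add_right_comm]
  exact ⟨mem_of_add_mem hG hR fun x hx ↦ Multiset.mem_add.2 (.inl (hRS x hx)),
    fun h ↦ add_mem h hR⟩

theorem isClifford_of_card_le_two (hG : Nat.card (commutator G) ≤ 2) :
    IsClifford (ClassSemigroup (productOneMonoid G)) := by
  intro a
  obtain ⟨S, rfl⟩ := classOf_surjective a
  have hmem : ∀ x ∈ Nat.card G • S, x ∈ S := fun x hx ↦ Multiset.mem_of_mem_nsmul hx
  have he := classOf_add_eq hG (card_nsmul_mem S) (fun x hx ↦ hx)
  have ha := classOf_add_eq hG (card_nsmul_mem S) hmem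
  -- The extra |G|·S makes the idempotent [|G|·S] fix the inverse, even when |G| = 1.
  refine ⟨_, isSubgroup_of_idempotent ((classOf_add _ _).symm.trans he), ?_, classOf _ ((Nat.card G - 1) • S + Nat.card G • S),
    ?_, ?_⟩
  · rw [← classOf_add, add_comm, ha]
  · rw [classOf_add, add_left_comm]
    congr 1
  · rw [← classOf_add, add_right_comm, ← succ_nsmul, Nat.sub_add_cancel Nat.card_pos, classOf_add]
    exact he

end Main

/-! ### From seminormality to |G'| ≤ 2. -/

section Commutators

variable {G : Type*} [Group G]

theorem mem_products_coe {l : List G} {x : G} :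
    x ∈ products (l : Multiset G) ↔ ∃ m ∈ l.permutations', m.prod = x := by
  simp only [products, Set.mem_ofPred_eq, Multiset.coe_eq_coe, List.mem_permutations']

/-- If `B(G)` is seminormal, then `π(T)` is a full coset of the commutator subgroup of the
subgroup generated by `T`. -/
theorem mul_mem_products [Finite G] (hQ : ContainsEventualRoots G) {T : Multiset G} {c t : G}
    (hc : c ∈ ⁅Subgroup.closure {x | x ∈ T}, Subgroup.closure {x | x ∈ T}⁆)
    (ht : t ∈ products T) : c * t ∈ products T := by
  obtain ⟨l, rfl, rfl⟩ := ht
  -- Appending this term gives the product c⁻¹, which lies in the commutator subgroup.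
  have h : (c * l.prod)⁻¹ ::ₘ (l : Multiset G) ∈ productOneMonoid G := by
    have hle : Subgroup.closure {x | x ∈ (l : Multiset G)} ≤
        Subgroup.closure {x | x ∈ (c * l.prod)⁻¹ ::ₘ (l : Multiset G)} := by
      refine Subgroup.closure_mono fun x hx ↦ ?_
      exact Multiset.mem_cons_of_mem (Set.mem_ofPred_eq ▸ hx)
    refine hQ _ (eventually_nsmul_mem (s := c⁻¹)
      ⟨l ++ [(c * l.prod)⁻¹], ?_, ?_⟩ (inv_mem (Subgroup.commutator_mono hle hle hc)))
    · exact Multiset.coe_eq_coe.2 List.perm_append_comm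
    · simp
  simpa using inv_mem_products_of_one_mem_cons h

theorem eq_one_or_eq_commutator [Finite G] (hQ : ContainsEventualRoots G) {g h c : G}
    (hc : c ∈ ⁅Subgroup.closure {g, h}, Subgroup.closure {g, h}⁆) : c = 1 ∨ c = ⁅g, h⁆ := by
  have hs : {x | x ∈ (([h, g] : List G) : Multiset G)} = {g, h} := by ext; simp [or_comm]
  have h1 := mul_mem_products hQ (hs ▸ hc) ⟨[h, g], rfl, rfl⟩
  rw [mem_products_coe] at h1
  simp only [List.permutations', List.permutations'Aux, List.flatMap_cons, List.flatMap_nil,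
    List.map_cons, List.map_nil, List.append_nil, List.mem_cons, List.not_mem_nil, or_false,
    exists_eq_or_imp, exists_eq_left, List.prod_cons, List.prod_nil, mul_one] at h1
  rcases h1 with h1 | h1
  · exact .inl (mul_eq_right.1 h1.symm)
  · right
    rw [commutatorElement_def, mul_assoc, ← mul_inv_rev, h1, mul_inv_cancel_right]

theorem commutator_mul_self [Finite G] (hQ : ContainsEventualRoots G) (g h : G) :
    ⁅g, h⁆ * ⁅g, h⁆ = 1 := by
  have hg : g ∈ Subgroup.closure {g, h} := Subgroup.subset_closure (by simp)
  have hh : h ∈ Subgroup.closure {g, h} := Subgroup.subset_closure (by simp)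
  rcases eq_one_or_eq_commutator hQ
    (inv_mem (Subgroup.commutator_mem_commutator hg hh)) with h1 | h1
  · rw [inv_eq_one.1 h1, one_mul]
  · nth_rw 1 [← h1]
    exact inv_mul_cancel _

/-- The conjugate of `⁅g, h⁆` by `g` is a commutator in ⟨g, h⟩, hence is 1 or `⁅g, h⁆`. -/
theorem commute_commutator [Finite G] (hQ : ContainsEventualRoots G) (g h : G) :
    Commute g ⁅g, h⁆ := by
  have hg : g ∈ Subgroup.closure {g, h} := Subgroup.subset_closure (by simp)
  have hh : h ∈ Subgroup.closure {g, h} := Subgroup.subset_closure (by simp)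
  have hconj : ⁅g, g * h * g⁻¹⁆ = g * ⁅g, h⁆ * g⁻¹ := by
    simp only [commutatorElement_def]; group
  rcases eq_one_or_eq_commutator hQ (Subgroup.commutator_mem_commutator hg
    (mul_mem (mul_mem hg hh) (inv_mem hg))) with h1 | h1
  · rw [hconj, conj_eq_one_iff] at h1
    rw [h1]
    exact Commute.one_right g
  · rw [hconj, mul_inv_eq_iff_eq_mul] at h1
    exact h1

/-- Moving `x` past two copies of `y` produces `⁅y, x⁆` twice, and these cancel. -/
theorem mul_self_mem_center [Finite G] (hQ : ContainsEventualRoots G) (y : G) :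
    y * y ∈ Subgroup.center G := by
  rw [Subgroup.mem_center_iff]
  intro x
  have h1 : y * x = ⁅y, x⁆ * x * y := by rw [commutatorElement_def]; group
  symm
  calc y * y * x = (y * ⁅y, x⁆) * x * y := by rw [mul_assoc, h1]; group
    _ = ⁅y, x⁆ * (y * x) * y := by rw [(commute_commutator hQ y x).eq]; group
    _ = (⁅y, x⁆ * ⁅y, x⁆) * x * y * y := by rw [h1]; group
    _ = x * (y * y) := by rw [commutator_mul_self hQ, one_mul, mul_assoc]

theorem commutator_mem_center [Finite G] (hQ : ContainsEventualRoots G) (x y : G) :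
    ⁅x, y⁆ ∈ Subgroup.center G := by
  -- A commutator is a product of squares and conjugates of inverse squares, all central.
  have h : ⁅x, y⁆ = (x * y) * (x * y) * (y⁻¹ * (x * x)⁻¹ * y) * (y * y)⁻¹ := by
    rw [commutatorElement_def]; group
  rw [h]
  exact mul_mem (mul_mem (mul_self_mem_center hQ _) (Subgroup.Normal.conj_mem' inferInstance _
    (inv_mem (mul_self_mem_center hQ _)) _)) (inv_mem (mul_self_mem_center hQ _))

theorem mul_comm_of_mem_center {z : G} (hz : z ∈ Subgroup.center G) (x : G) : x * z = z * x :=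
  Subgroup.mem_center_iff.1 hz x

theorem commutator_mul_left_of_central (hcen : ∀ x y : G, ⁅x, y⁆ ∈ Subgroup.center G)
    (x y z : G) : ⁅x * y, z⁆ = ⁅x, z⁆ * ⁅y, z⁆ := by
  have h : ⁅x * y, z⁆ = x * ⁅y, z⁆ * x⁻¹ * ⁅x, z⁆ := by simp only [commutatorElement_def]; group
  rw [h, mul_comm_of_mem_center (hcen y z), mul_inv_cancel_right,
    mul_comm_of_mem_center (hcen x z)]

theorem commutator_mul_right_of_central (hcen : ∀ x y : G, ⁅x, y⁆ ∈ Subgroup.center G)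
    (x y z : G) : ⁅x, y * z⁆ = ⁅x, y⁆ * ⁅x, z⁆ := by
  have h : ⁅x, y * z⁆ = ⁅x, y⁆ * (y * ⁅x, z⁆ * y⁻¹) := by
    simp only [commutatorElement_def]; group
  rw [h, mul_comm_of_mem_center (hcen x z), mul_inv_cancel_right]

theorem commutator_comm_of_involutive (hsq : ∀ x y : G, ⁅x, y⁆ * ⁅x, y⁆ = 1) (x y : G) :
    ⁅x, y⁆ = ⁅y, x⁆ := by
  rw [← commutatorElement_inv y x]
  exact inv_eq_of_mul_eq_one_left (hsq y x)

theorem mul_eq_commutator_mul_swap (hsq : ∀ x y : G, ⁅x, y⁆ * ⁅x, y⁆ = 1) (x y : G) :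
    y * x = ⁅x, y⁆ * (x * y) := by
  rw [commutator_comm_of_involutive hsq, commutatorElement_def]; group

/-- With a = `⁅g, h⁆`, b = `⁅g, k⁆`, c = `⁅h, k⁆`, the six orderings of g, h, k have products ghk
times 1, a, c, ab, bc, abc. One of these factors must equal b. -/
theorem commutator_eq_of_ne [Finite G] (hQ : ContainsEventualRoots G) {g h k : G}
    (ha : ⁅g, h⁆ ≠ 1) (hb : ⁅g, k⁆ ≠ 1) (hab : ⁅g, h⁆ ≠ ⁅g, k⁆) :
    ⁅h, k⁆ = 1 ∨ ⁅h, k⁆ = ⁅g, h⁆ ∨ ⁅h, k⁆ = ⁅g, k⁆ := by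
  have hsq := commutator_mul_self hQ
  have hcen := commutator_mem_center hQ
  have hsub : ∀ {x}, x ∈ ([g, h, k] : List G) →
      x ∈ Subgroup.closure {x | x ∈ (([g, h, k] : List G) : Multiset G)} :=
    fun hx ↦ Subgroup.subset_closure hx
  have h1 := mul_mem_products hQ (Subgroup.commutator_mem_commutator
    (hsub (x := g) (by simp)) (hsub (x := k) (by simp))) ⟨[g, h, k], rfl, rfl⟩
  rw [mem_products_coe] at h1
  simp only [List.permutations', List.permutations'Aux, List.flatMap_cons, List.flatMap_nil,
    List.map_cons, List.map_nil, List.append_nil, List.mem_cons, List.not_mem_nil, or_false,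
    exists_eq_or_imp, exists_eq_left, List.prod_cons, List.prod_nil, mul_one, List.cons_append,
    List.nil_append] at h1
  have hgh := mul_eq_commutator_mul_swap hsq g h
  have hgk := mul_eq_commutator_mul_swap hsq g k
  have hhk := mul_eq_commutator_mul_swap hsq h k
  have hac := hsq g h
  have hbb := hsq g k
  have hcc := hsq h k
  have hca := hcen g h
  have hcb := hcen g k
  have hcc' := hcen h k
  generalize ⁅g, h⁆ = a at *
  generalize ⁅g, k⁆ = b at *
  generalize ⁅h, k⁆ = c at *
  have e1 : h * (g * k) = a * (g * (h * k)) := by rw [← mul_assoc, hgh]; group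
  have e2 : g * (k * h) = c * (g * (h * k)) := by
    rw [hhk, ← mul_assoc, mul_comm_of_mem_center hcc', mul_assoc]
  have e3 : h * (k * g) = b * (a * (g * (h * k))) := by
    rw [hgk, ← mul_assoc, mul_comm_of_mem_center hcb, mul_assoc, e1]
  have e4 : k * (g * h) = b * (c * (g * (h * k))) := by
    rw [← mul_assoc, hgk, mul_assoc, mul_assoc, e2]
  have e5 : k * (h * g) = a * (b * (c * (g * (h * k)))) := by
    rw [hgh, ← mul_assoc, mul_comm_of_mem_center hca, mul_assoc, e4]
  rw [e1, e2, e3, e4, e5] at h1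
  rw [← mul_assoc a b, ← mul_comm_of_mem_center hca b, mul_assoc b a] at h1
  simp only [← mul_assoc, mul_left_inj] at h1
  simp only [mul_assoc, mul_eq_left, right_eq_mul] at h1
  have hac' : a * c = 1 → c = a := fun he ↦ mul_left_cancel (he.trans hac.symm)
  rcases h1 with h1 | h1 | h1 | h1 | h1 | h1
  · exact absurd h1 hb
  · exact absurd h1 hab
  · exact absurd h1 ha
  · exact .inr (.inr h1)
  · exact .inl h1
  · exact .inr (.inl (hac' h1))

theorem commutator_eq_of_common_left [Finite G] (hQ : ContainsEventualRoots G) {g h k : G}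
    (ha : ⁅g, h⁆ ≠ 1) (hb : ⁅g, k⁆ ≠ 1) : ⁅g, h⁆ = ⁅g, k⁆ := by
  by_contra hab
  have hsq := commutator_mul_self hQ
  have hcen := commutator_mem_center hQ
  have e1 : ⁅g, h * g⁆ = ⁅g, h⁆ := by
    rw [commutator_mul_right_of_central hcen, commutatorElement_self, mul_one]
  have e2 : ⁅g, k * g⁆ = ⁅g, k⁆ := by
    rw [commutator_mul_right_of_central hcen, commutatorElement_self, mul_one]
  have e3 : ⁅h * g, k⁆ = ⁅h, k⁆ * ⁅g, k⁆ := commutator_mul_left_of_central hcen _ _ _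
  have e4 : ⁅h, k * g⁆ = ⁅h, k⁆ * ⁅g, h⁆ := by
    rw [commutator_mul_right_of_central hcen, commutator_comm_of_involutive hsq h g]
  have e5 : ⁅h * g, k * g⁆ = ⁅h, k⁆ * ⁅g, h⁆ * ⁅g, k⁆ := by
    rw [commutator_mul_left_of_central hcen, e4, e2]
  -- Multiplying `h` or `k` by `g` keeps a and b but turns c into cb, ca or cab. All four would lie
  -- in {1, a, b}, yet one of them is ab, which does not.
  have h1 := commutator_eq_of_ne hQ ha hb hab
  have h2 := commutator_eq_of_ne (h := h * g) (k := k) hQ (by rwa [e1]) hb (by rwa [e1])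
  have h3 := commutator_eq_of_ne (h := h) (k := k * g) hQ ha (by rwa [e2]) (by rwa [e2])
  have h4 := commutator_eq_of_ne (h := h * g) (k := k * g) hQ (by rwa [e1]) (by rwa [e2])
    (by rwa [e1, e2])
  rw [e3, e1] at h2
  rw [e4, e2] at h3
  rw [e5, e1, e2] at h4
  have haa := hsq g h
  have hbb := hsq g k
  have hcomm := mul_comm_of_mem_center (hcen g h) ⁅g, k⁆
  generalize ⁅g, h⁆ = a at *
  generalize ⁅g, k⁆ = b at *
  generalize ⁅h, k⁆ = c at *
  have hab1 : a * b ≠ 1 := fun he ↦ hab (mul_right_cancel (he.trans hbb.symm))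
  rcases h1 with rfl | rfl | rfl
  · simp [ha, hb, hab1] at h4
  · simp [ha, hb, hab1] at h2
  · simp [ha, hb, hab1, hcomm] at h3

theorem commutator_eq_commutator [Finite G] (hQ : ContainsEventualRoots G) {g h k l : G}
    (ha : ⁅g, h⁆ ≠ 1) (hb : ⁅k, l⁆ ≠ 1) : ⁅g, h⁆ = ⁅k, l⁆ := by
  by_contra hab
  have hcen := commutator_mem_center hQ
  have hcomm := commutator_comm_of_involutive (commutator_mul_self hQ)
  -- A nontrivial `⁅g, l⁆` would link the two commutators through common entries. Once the cross
  -- terms vanish, `g * k` serves as a common left entry.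
  have cross : ∀ {g h k l : G}, ⁅g, h⁆ ≠ 1 → ⁅k, l⁆ ≠ 1 → ⁅g, h⁆ ≠ ⁅k, l⁆ → ⁅g, l⁆ = 1 := by
    intro g h k l ha hb hab
    by_contra h1
    apply hab
    rw [commutator_eq_of_common_left hQ ha h1, hcomm g l, hcomm k l]
    exact commutator_eq_of_common_left hQ (by rwa [hcomm l g]) (by rwa [hcomm l k])
  have h1 : ⁅g, l⁆ = 1 := cross ha hb hab
  have h2 : ⁅k, h⁆ = 1 := cross hb ha (Ne.symm hab)
  have e1 : ⁅g * k, h⁆ = ⁅g, h⁆ := by rw [commutator_mul_left_of_central hcen, h2, mul_one]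
  have e2 : ⁅g * k, l⁆ = ⁅k, l⁆ := by rw [commutator_mul_left_of_central hcen, h1, one_mul]
  apply hab
  rw [← e1, ← e2]
  exact commutator_eq_of_common_left hQ (by rwa [e1]) (by rwa [e2])

theorem card_commutator_le_two [Finite G] (hQ : ContainsEventualRoots G) :
    Nat.card (commutator G) ≤ 2 := by
  obtain ⟨z, hz, hall⟩ : ∃ z : G, z * z = 1 ∧ ∀ x y : G, ⁅x, y⁆ = 1 ∨ ⁅x, y⁆ = z := by
    by_cases h : ∃ x y : G, ⁅x, y⁆ ≠ 1
    · obtain ⟨x, y, hxy⟩ := h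
      refine ⟨⁅x, y⁆, commutator_mul_self hQ x y, fun u v ↦ ?_⟩
      exact or_iff_not_imp_left.2 fun huv ↦ commutator_eq_commutator hQ huv hxy
    · push Not at h
      exact ⟨1, one_mul 1, fun x y ↦ .inl (h x y)⟩
  have hle : commutator G ≤ Subgroup.zpowers z := by
    rw [commutator_def, Subgroup.commutator_le]
    rintro x - y -
    rcases hall x y with h | h <;> rw [h]
    · exact one_mem _
    · exact Subgroup.mem_zpowers z
  calc Nat.card (commutator G) ≤ Nat.card (Subgroup.zpowers z) := Subgroup.card_le_of_le hle
    _ = orderOf z := Nat.card_zpowers z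
    _ ≤ 2 := orderOf_le_of_pow_eq_one two_pos (by rw [sq, hz])

end Commutators

end ProductOne

theorem corollary3p12 (G : Type*) [Group G] [Finite G] :
    List.TFAE
      [Nat.card (commutator G) ≤ 2,
        ProductOne.IsSeminormal (ProductOne.productOneMonoid G),
        ProductOne.IsClifford (ProductOne.ClassSemigroup (ProductOne.productOneMonoid G))] ∧
    (Nat.card (commutator G) ≤ 2 →
      (ProductOne.productOneMonoid G : Set (Multiset G)) =
        {S : Multiset G | ProductOne.classOf (ProductOne.productOneMonoid G) S ∈
          ProductOne.idempotents
            (ProductOne.ClassSemigroup (ProductOne.productOneMonoid G))}) := by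
  
  refine ⟨?_, fun hG ↦ Set.ext fun S ↦ ⟨fun hS ↦ ?_, ProductOne.mem_of_classOf_idempotent⟩⟩
  · tfae_have 1 → 3 := ProductOne.isClifford_of_card_le_two
    tfae_have 3 → 2 := fun h ↦
      ProductOne.isSeminormal_iff.2 (ProductOne.containsEventualRoots_of_isClifford h)
    tfae_have 2 → 1 := fun h ↦ ProductOne.card_commutator_le_two (ProductOne.isSeminormal_iff.1 h)
    tfae_finish
  · exact (ProductOne.classOf_add S S).symm.trans
      (ProductOne.classOf_add_eq hG hS fun x hx ↦ hx)
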